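/- **Setting (sequential privacy scheme, one time step).** Let $1\le p\le d$. Let $S\in\mathbb R^{d\times d}$ be symmetric positive definite, $S=V\Lambda V^{T}$ with $V$ orthogonal and $\Lambda=\mathrm{diag}(\lambda_1\ge\dots\ge\lambda_d)$. On a probability space let $r$ be a random vector in $\mathbb R^d$ (the residual, of arbitrary law), $\hat V$ a random orthogonal matrix, $\xi_1,\dots,\xi_d$ i.i.d. Laplace variables centred at $0$ with scale $\Delta_l/\epsilon_{cov}$ ($\Delta_l,\epsilon_{cov}>0$), and $e\sim N(0,\sigma^2 I_p)$, $\sigma>0$, independent of $(r,\hat V,\xi)$. Put $$\tau=\big(\lambda_i^{-1/2}(V^{T}r)_i\big)_{i\le p},\qquad \hat\tau^{cov}=\big(s_i(\hat V^{T}r)_i\big)_{i\le p},\qquad \hat\tau^{res}=\hat\tau^{cov}+e,$$ where $s_i$ is the whitening factor obtained from the noisy eigenvalue: $s_i=(\lambda_i+\xi_i)^{-1/2}$, or $s_i=\lambda_i^{-1/2}+\xi_i$, or $s_i=(\lambda_i^{-1}+\xi_i)^{1/2}$, according to whether the eigenvalues of $S$, of $S^{-1/2}$ or of $S^{-1}$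 are perturbed (the same choice for all $i$; in the first and third case $s_i=0$ if the noisy eigenvalue is $\le 0$). The theorem holds for each of the three. Let $T=\|\tau\|_2^2$, $\hat T^{cov}=\|\hat\tau^{cov}\|_2^2$, $\hat T^{res}=\|\hat\tau^{res}\|_2^2$. Let $\alpha,\hat\alpha\in(0,1)$, let $\chi^2_\alpha$ be the upper $\alpha$-quantile of $\chi^2_p$, and $\chi^{2,NC}_{\hat\alpha}$ the upper $\hat\alpha$-quantile of the non-central distribution $\chi^2(p,\hat T^{cov})$ ($p$ degrees of freedom, non-centrality $\hat T^{cov}$). The alarms are: $\rho=1$ if $T>\chi^2_\alpha$ and $\rho=0$ otherwise; $\hat\rho=1$ if $\hat T^{res}>\sigma^2\chi^{2,NC}_{\hat\alpha}$ and $\hat\rho=0$ otherwise. For $v\in\mathbb R^p$ let $F^{v}_{\chi^2,p}(x)=\mathbb P(\sigma^2 X\le x)$ with $X\sim\chi^2(p,\|v\|_2^2/\sigma^2)$, i.e. the CDF of $\|v+e\|_2^2$. Let $\gamma_{cov}\in(0,1)$, $\theta_l=\frac{\Delta_l}{\epsilon_{cov}}\log\frac{d}{\gamma_{cov}}$, and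 $R=\sum_{i=1}^p(r^i)^2$, where $r^1,\dots,r^d$ are the coordinates of $r$ in any fixed orthonormal basis of $\mathbb R^d$. Let $r_{max}$ be a vector of largest norm in a (possibly random) set of admissible residuals that contains $r$, with $r_{max}\neq0$ almost surely, and $\hat\tau^{cov}_{max}$ a vector of largest norm in a (possibly random) set of admissible vectors of $\mathbb R^p$ that contains $\hat\tau^{cov}$; both are measurable. Put $$\omega_1=1-F^{gamma}(R\,\theta_l),\qquad \omega_2=\big[F^{ex}(\theta_l)\big]^p,\qquad \hat T=T+\sigma^2\chi^{2,NC}_{\hat\alpha}-\chi^2_\alpha,$$ where $F^{gamma}$ is the CDF of the Gamma distribution with shape $p$ and rate $\epsilon_{cov}/(\Delta_l\|r_{max}\|_2^2)$, and $F^{ex}$ that of the exponential distribution of rate $\epsilon_{cov}/\Delta_l$. **Theorem (misclassification rates).** Almost surely on the event $\{\rho=0\}$, $$\mathbb P[\hat\rho=1\mid r,\hat\tau^{cov}]\le \omega_1\Big[1-F^{\hat\tau^{cov}}_{\chi^2,p}(\hat T)\Big]+\omega_2\Big[1-F^{\hat\tau^{cov}_{max}}_{\chi^2,p}(\hat T)\Big],$$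 and almost surely on the event $\{\rho=1\}$, $$\mathbb P[\hat\rho=0\mid r,\hat\tau^{cov}]\le F^{\hat\tau^{cov}}_{\chi^2,p}(\hat T)\,\big[\omega_1+\omega_2\big].$$ Consequently, whenever the conditioning events have positive probability, $$\mathbb P[\hat\rho=1\mid\rho=0]\le\mathbb E\Big[\omega_1\big(1-F^{\hat\tau^{cov}}_{\chi^2,p}(\hat T)\big)+\omega_2\big(1-F^{\hat\tau^{cov}_{max}}_{\chi^2,p}(\hat T)\big)\,\Big|\,\rho=0\Big],$$ $$\mathbb P[\hat\rho=0\mid\rho=1]\le\mathbb E\Big[F^{\hat\tau^{cov}}_{\chi^2,p}(\hat T)\,(\omega_1+\omega_2)\,\Big|\,\rho=1\Big].$$ -/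

import Mathlib

open MeasureTheory ProbabilityTheory
open scoped Matrix ENNReal

noncomputable section

/-- The Laplace distribution on `ℝ` centred at `0` with scale `b > 0`,
with density `x ↦ (2 b)⁻¹ exp (- |x| / b)`. -/
def laplaceMeasure (b : ℝ) : Measure ℝ :=
  volume.withDensity fun x => ENNReal.ofReal ((2 * b)⁻¹ * Real.exp (-|x| / b))

/-- The non-central `χ²` distribution with `k ≥ 1` degrees of freedom and non-centrality
parameter `nc ≥ 0`: the law of `∑ i, (Z i + a i) ^ 2` for a standard Gaussian vector `Z` in `ℝ^k`
and the vector `a` with all coordinates equal to `√(nc / k)`, for which `∑ i, (a i) ^ 2 = nc`. -/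
def noncentralChiSq (k : ℕ) (nc : ℝ) : Measure ℝ :=
  (stdGaussian (EuclideanSpace ℝ (Fin k))).map fun z =>
    ‖z + WithLp.toLp 2 (fun _ : Fin k => √(nc / k))‖ ^ 2

/-- The (central) `χ²` distribution with `k` degrees of freedom. -/
def chiSq (k : ℕ) : Measure ℝ := noncentralChiSq k 0

/-- The upper quantile of level `a` of a probability measure on `ℝ`: the least `x` whose tail
probability `ν (x, ∞)` is at most `a`. -/
def upperQuantile (ν : Measure ℝ) (a : ℝ) : ℝ := sInf {x : ℝ | 1 - cdf ν x ≤ a}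

/-- The non-central `χ²` CDF on the scale of the test statistic `‖v + e‖ ^ 2`, `e ∼ N(0, σ² I)`:
the value at `x` of the CDF of `σ² · χ²(p, ‖v‖² / σ²)`. For `σ = 1` it is the CDF of
`χ²(p, ‖v‖²)`. -/
def scaledNCChiSqCDF {p : ℕ} (σ : ℝ) (v : EuclideanSpace ℝ (Fin p)) (x : ℝ) : ℝ :=
  cdf (noncentralChiSq p (‖v‖ ^ 2 / σ ^ 2)) (x / σ ^ 2)

/-- The matrix whose eigenvalues receive the Laplace noise: the covariance `S`, its inverse square
root (the whitening matrix), or its inverse (the precision matrix). -/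
inductive EigenTarget where
  | covariance
  | whitening
  | precision

/-- The factor by which a principal coordinate of the residual is multiplied once the eigenvalue
of the target matrix that belongs to the eigenvalue `l` of `S` is perturbed by `x`. A perturbed
eigenvalue of `S` or `S⁻¹` that is not positive has its direction dropped (factor `0`). -/
def perturbedScale : EigenTarget → ℝ → ℝ → ℝ
  | .covariance, l, x => (√(l + x))⁻¹
  | .whitening, l, x => (√l)⁻¹ + x
  | .precision, l, x => √(l⁻¹ + x)

/-- The vector `(s i * (Wᵀ u) i)_{i < p}`, that is the first `p` coordinates of
`diag(s) Wᵀ u`. -/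
def scaledScores {p d : ℕ} (h : p ≤ d) (W : Matrix (Fin d) (Fin d) ℝ) (s : Fin d → ℝ)
    (u : EuclideanSpace ℝ (Fin d)) : EuclideanSpace ℝ (Fin p) :=
  WithLp.toLp 2 fun i => s (Fin.castLE h i) * (Wᵀ *ᵥ (fun j => u j)) (Fin.castLE h i)

/-- An alarm: `1` if the statistic exceeds the threshold, `0` otherwise. -/
def alarmOf (stat threshold : ℝ) : ℕ := if threshold < stat then 1 else 0

/-- The sequential privacy scheme at one time step, on a probability space `(Ω, P)`: the residual
covariance with its spectral decomposition, the residual, the covariance noise, the residual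
noise, and the privacy and test parameters. -/
structure SequentialPrivacyScheme {Ω : Type*} [MeasurableSpace Ω] (P : Measure Ω) (p d : ℕ) where
  one_le_p : 1 ≤ p
  p_le_d : p ≤ d
  /-- the residual covariance matrix predicted by the filter -/
  S : Matrix (Fin d) (Fin d) ℝ
  S_posDef : S.PosDef
  /-- an orthogonal matrix of eigenvectors of `S` -/
  V : Matrix (Fin d) (Fin d) ℝ
  V_orthogonal : V ∈ Matrix.orthogonalGroup (Fin d) ℝ
  /-- the eigenvalues of `S`, the largest first -/
  lam : Fin d → ℝ
  lam_antitone : Antitone lam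
  spectral : S = V * Matrix.diagonal lam * Vᵀ
  /-- the covariance privacy parameter `ε_cov` -/
  epsCov : ℝ
  epsCov_pos : 0 < epsCov
  /-- the sensitivity `Δ_l` -/
  sens : ℝ
  sens_pos : 0 < sens
  /-- the covariance privacy parameter `γ_cov` -/
  gamCov : ℝ
  gamCov_pos : 0 < gamCov
  gamCov_lt_one : gamCov < 1
  /-- the scale of the Gaussian noise -/
  σ : ℝ
  σ_pos : 0 < σ
  /-- the level of significance of the utility -/
  α : ℝ
  α_pos : 0 < α
  α_lt_one : α < 1
  /-- the level of significance of the regulator -/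
  αHat : ℝ
  αHat_pos : 0 < αHat
  αHat_lt_one : αHat < 1
  /-- which matrix has its eigenvalues perturbed -/
  target : EigenTarget
  /-- the residual, of arbitrary law -/
  r : Ω → EuclideanSpace ℝ (Fin d)
  r_measurable : Measurable r
  /-- the disclosed orthogonal matrix of eigenvectors -/
  VHat : Ω → Matrix (Fin d) (Fin d) ℝ
  VHat_orthogonal : ∀ ω, VHat ω ∈ Matrix.orthogonalGroup (Fin d) ℝ
  VHat_measurable : ∀ i j, Measurable fun ω => VHat ω i j
  /-- the noise on the eigenvalues: independent, with law `Lap(Δ_l / ε_cov)` -/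
  ξ : Fin d → Ω → ℝ
  ξ_measurable : ∀ i, Measurable (ξ i)
  ξ_indep : iIndepFun ξ P
  ξ_law : ∀ i, HasLaw (ξ i) (laplaceMeasure (sens / epsCov)) P
  /-- the noise on the residual: `N(0, σ² I)`, independent of everything before -/
  e : Ω → EuclideanSpace ℝ (Fin p)
  e_measurable : Measurable e
  e_law : HasLaw e (multivariateGaussian 0 (σ ^ 2 • (1 : Matrix (Fin p) (Fin p) ℝ))) P
  e_indep : IndepFun e
    (fun ω => (r ω, (fun i j => VHat ω i j : Fin d → Fin d → ℝ), fun i => ξ i ω)) P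

namespace SequentialPrivacyScheme

variable {Ω : Type*} [MeasurableSpace Ω] {P : Measure Ω} {p d : ℕ}
  (M : SequentialPrivacyScheme P p d)

/-- The whitened residual `τ = Λ^{-1/2} Vᵀ r` on the top `p` principal components. -/
def tau (ω : Ω) : EuclideanSpace ℝ (Fin p) :=
  scaledScores M.p_le_d M.V (fun i => (√(M.lam i))⁻¹) (M.r ω)

/-- The utility's test statistic `T = ‖τ‖²`. -/
def T (ω : Ω) : ℝ := ‖M.tau ω‖ ^ 2

/-- The residual whitened with the privatized covariance, `τ̂^cov`. -/
def tauCov (ω : Ω) : EuclideanSpace ℝ (Fin p) :=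
  scaledScores M.p_le_d (M.VHat ω) (fun i => perturbedScale M.target (M.lam i) (M.ξ i ω)) (M.r ω)

/-- The test statistic `T̂^cov = ‖τ̂^cov‖²`. -/
def TCov (ω : Ω) : ℝ := ‖M.tauCov ω‖ ^ 2

/-- The disclosed residual `τ̂^res = τ̂^cov + e`. -/
def tauRes (ω : Ω) : EuclideanSpace ℝ (Fin p) := M.tauCov ω + M.e ω

/-- The regulator's test statistic `T̂^res = ‖τ̂^res‖²`. -/
def TRes (ω : Ω) : ℝ := ‖M.tauRes ω‖ ^ 2

/-- The utility's threshold, the upper `α` quantile of `χ²_p`. -/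
def chiThreshold : ℝ := upperQuantile (chiSq p) M.α

/-- The upper `α̂` quantile of the non-central distribution `χ²(p, T̂^cov)`. -/
def ncThreshold (ω : Ω) : ℝ := upperQuantile (noncentralChiSq p (M.TCov ω)) M.αHat

/-- The utility's alarm `ρ`. -/
def rho (ω : Ω) : ℕ := alarmOf (M.T ω) M.chiThreshold

/-- The regulator's alarm `ρ̂`. -/
def rhoHat (ω : Ω) : ℕ := alarmOf (M.TRes ω) (M.σ ^ 2 * M.ncThreshold ω)

/-- `T̂ = T + σ² χ^{2,NC}_α̂ - χ²_α`. -/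
def THat (ω : Ω) : ℝ := M.T ω + M.σ ^ 2 * M.ncThreshold ω - M.chiThreshold

/-- `θ_l = (Δ_l / ε_cov) log (d / γ_cov)`. -/
def theta : ℝ := M.sens / M.epsCov * Real.log (d / M.gamCov)

/-- `R = ∑_{i < p} (r^i)²`, with the coordinates of the residual taken in the basis `b`. -/
def R (b : OrthonormalBasis (Fin d) ℝ (EuclideanSpace ℝ (Fin d))) (ω : Ω) : ℝ :=
  ∑ i : Fin p, (b.repr (M.r ω) (Fin.castLE M.p_le_d i)) ^ 2

/-- `ω₁ = 1 - F^gamma(R θ_l)`, for `Gamma(p, ε_cov / (Δ_l ‖r_max‖²))` in shape-rate form. -/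
def weightOne (b : OrthonormalBasis (Fin d) ℝ (EuclideanSpace ℝ (Fin d)))
    (rmax : Ω → EuclideanSpace ℝ (Fin d)) (ω : Ω) : ℝ :=
  1 - cdf (gammaMeasure p (M.epsCov / (M.sens * ‖rmax ω‖ ^ 2))) (M.R b ω * M.theta)

/-- `ω₂ = (F^ex(θ_l))^p`, for the exponential law of rate `ε_cov / Δ_l`. -/
def weightTwo : ℝ := (cdf (expMeasure (M.epsCov / M.sens)) M.theta) ^ p

/-- `F^{v}_{χ²,p}(x)`, the non-central `χ²` CDF attached to the vector `v`. -/
def F (v : EuclideanSpace ℝ (Fin p)) (x : ℝ) : ℝ := scaledNCChiSqCDF M.σ v x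

/-- The `σ`-algebra generated by the residual and `τ̂^cov`. -/
@[reducible]
def given : MeasurableSpace Ω :=
  MeasurableSpace.comap (fun ω => (M.r ω, M.tauCov ω)) inferInstance

/-- `ω₁ [1 - F^{τ̂^cov}(T̂)] + ω₂ [1 - F^{τ̂^cov_max}(T̂)]`. -/
def falseAlarmBound (b : OrthonormalBasis (Fin d) ℝ (EuclideanSpace ℝ (Fin d)))
    (rmax : Ω → EuclideanSpace ℝ (Fin d)) (tauMax : Ω → EuclideanSpace ℝ (Fin p)) (ω : Ω) : ℝ :=
  M.weightOne b rmax ω * (1 - M.F (M.tauCov ω) (M.THat ω)) +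
    M.weightTwo * (1 - M.F (tauMax ω) (M.THat ω))

/-- `F^{τ̂^cov}(T̂) [ω₁ + ω₂]`. -/
def missedAlarmBound (b : OrthonormalBasis (Fin d) ℝ (EuclideanSpace ℝ (Fin d)))
    (rmax : Ω → EuclideanSpace ℝ (Fin d)) (ω : Ω) : ℝ :=
  M.F (M.tauCov ω) (M.THat ω) * (M.weightOne b rmax ω + M.weightTwo)

end SequentialPrivacyScheme

end

/-!
Given the residual and `τ̂^cov`, the Gaussian noise `e` is the only randomness left in the
regulator's statistic. By independence the conditional probability of a missed alarm is therefore
`F(σ² q)`, where `F` is the distribution function of `‖τ̂^cov + e‖²` and `q` is the non-central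
quantile, and that of a false alarm is `1 - F(σ² q)` (`condProb_rhoHat_eq_zero`,
`condProb_rhoHat_eq_one`). The number `T̂` differs from `σ² q` by `T - χ²_α`, whose sign is the
utility's decision. Since `F` is monotone, replacing `σ² q` by `T̂` only increases the two
probabilities on the respective events.

What remains is to insert the weights and the vector `τ̂^cov_max`.

* The weights satisfy `ω₁ + ω₂ ≥ 1` (`one_le_weightOne_add_weightTwo`). After rescaling by
  `R ≤ ‖r‖² ≤ ‖r_max‖²` this says that a gamma variable of shape `p` is at most `t` with probability
  at most `(1 - exp (-t)) ^ p`, the probability that `p` independent exponential variables are all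
  at most `t` (`one_sub_exp_mul_sum_le_pow`).
* The non-central chi-squared distribution function decreases as the non-centrality grows
  (`scaledNCChiSqCDF_anti`). This is the fact that a ball has less Gaussian mass the farther its
  centre is from the origin (`stdGaussian_ball_anti`), which follows by reflecting one ball onto the
  other. It also shows that only the norm of the shift matters, so that `F` really is the
  distribution function of `‖τ̂^cov + e‖²` (`scaledNCChiSqCDF_eq`).

The bounds on the elementary conditional probabilities follow by integrating over the events
`ρ = 0` and `ρ = 1`, which belong to the conditioning `σ`-algebra
(`cond_real_le_integral_of_condExp_le`). The bounds are integrable: they are bounded, and measurable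
because the quantile is monotone in the non-centrality and `ω₁` has an explicit formula where
`r_max ≠ 0`.
-/

/-! ### The standard Gaussian measure and balls -/

lemma pi_gaussianReal_eq_withDensity {ι : Type*} [Fintype ι] :
    Measure.pi (fun _ : ι => gaussianReal 0 1) =
      (volume : Measure (ι → ℝ)).withDensity
        fun x => ENNReal.ofReal (∏ i, gaussianPDFReal 0 1 (x i)) := by
  refine (Measure.pi_eq fun s hs => ?_)
  have hint : Integrable (fun x : ι → ℝ => ∏ i, gaussianPDFReal 0 1 (x i))
      (Measure.pi fun i => volume.restrict (s i)) :=
    Integrable.fintype_prod fun i => (integrable_gaussianPDFReal 0 1).restrict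
  rw [withDensity_apply _ (MeasurableSet.univ_pi hs), volume_pi, Measure.restrict_pi_pi,
    ← ofReal_integral_eq_lintegral_ofReal hint
      (ae_of_all _ fun x => Finset.prod_nonneg fun i _ => gaussianPDFReal_nonneg 0 1 _),
    integral_fintype_prod_eq_prod (f := fun _ => gaussianPDFReal 0 1),
    ENNReal.ofReal_prod_of_nonneg fun i _ =>
      integral_nonneg fun x => gaussianPDFReal_nonneg 0 1 x]
  exact Finset.prod_congr rfl fun i _ => (gaussianReal_apply_eq_integral 0 one_ne_zero _).symm

lemma stdGaussian_eq_withDensity {ι : Type*} [Fintype ι] :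
    stdGaussian (EuclideanSpace ℝ ι) =
      (volume : Measure (EuclideanSpace ℝ ι)).withDensity fun z =>
        ENNReal.ofReal ((√(2 * Real.pi))⁻¹ ^ Fintype.card ι * Real.exp (-(‖z‖ ^ 2) / 2)) := by
  ext s hs
  have hdens : ∀ x : ι → ℝ, ∏ i, gaussianPDFReal 0 1 (x i) =
      (√(2 * Real.pi))⁻¹ ^ Fintype.card ι *
        Real.exp (-(‖(WithLp.toLp 2 x : EuclideanSpace ℝ ι)‖ ^ 2) / 2) := by
    intro x
    simp [gaussianPDFReal, Finset.prod_mul_distrib, EuclideanSpace.real_norm_sq_eq,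
      ← Real.exp_sum, Finset.sum_div, neg_div]
  rw [← map_pi_eq_stdGaussian, pi_gaussianReal_eq_withDensity,
    Measure.map_apply (by fun_prop) hs,
    withDensity_apply _ ((WithLp.measurable_toLp 2 (ι → ℝ)) hs), withDensity_apply _ hs,
    ← (PiLp.volume_preserving_toLp ι).setLIntegral_comp_preimage hs (by fun_prop)]
  simp_rw [hdens]

/-- The reflection exchanging the points `-a` and `-b`. It does not increase the norm of a point on
the side of `-b`, since the origin lies on the side of `-a`. -/
lemma exists_measurePreserving_swap {E : Type*} [NormedAddCommGroup E] [InnerProductSpace ℝ E]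
    [FiniteDimensional ℝ E] [MeasurableSpace E] [BorelSpace E] (a b : E) (hab : ‖a‖ ≤ ‖b‖) :
    ∃ f : E → E, MeasurePreserving f ∧ (∀ z, ‖f z + a‖ = ‖z + b‖) ∧ (∀ z, ‖f z + b‖ = ‖z + a‖) ∧
      ∀ z, ‖z + b‖ ≤ ‖z + a‖ → ‖f z‖ ≤ ‖z‖ := by
  set K : Submodule ℝ E := (ℝ ∙ (a - b))ᗮ with hK
  set m : E := (2⁻¹ : ℝ) • (a + b) with hm
  have hw : K.reflection ((2⁻¹ : ℝ) • (a - b)) = -((2⁻¹ : ℝ) • (a - b)) := by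
    rw [map_smul, Submodule.reflection_orthogonalComplement_singleton_eq_neg, smul_neg]
  refine ⟨fun z => K.reflection (z + m) - m, ?_, fun z => ?_, fun z => ?_, fun z hz => ?_⟩
  · exact (measurePreserving_sub_right volume m).comp
      (K.reflection.measurePreserving.comp (measurePreserving_add_right volume m))
  · have : K.reflection (z + m) - m + a = K.reflection (z + b) := by
      have h1 : z + b = (z + m) - (2⁻¹ : ℝ) • (a - b) := by rw [hm]; module
      rw [h1, map_sub, hw, hm]; module
    simp only [this, LinearIsometryEquiv.norm_map]
  · have : K.reflection (z + m) - m + b = K.reflection (z + a) := by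
      have h1 : z + a = (z + m) + (2⁻¹ : ℝ) • (a - b) := by rw [hm]; module
      rw [h1, map_add K.reflection (z + m), hw, hm]; module
    simp only [this, LinearIsometryEquiv.norm_map]
  -- The reflection is `z ↦ z - 2 c w` with `c ≥ 0` on the side of `-b`, so
  -- `‖f z‖² = ‖z‖² + 4 c ⟪w, m⟫`, and `2 ⟪w, m⟫ = ‖a‖² - ‖b‖² ≤ 0`.
  · set w : E := a - b with hwdef
    set c : ℝ := inner ℝ w (z + m) / ‖w‖ ^ 2 with hc
    have hf : K.reflection (z + m) - m = z - (2 * c) • w := by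
      simp only [hK]
      rw [Submodule.reflection_orthogonal_apply, Submodule.reflection_singleton_apply]
      simp only [RCLike.ofReal_real_eq_id, id_eq, ← hc]
      module
    have hcw : c * ‖w‖ ^ 2 = inner ℝ w (z + m) := by
      rcases eq_or_ne w 0 with h | h
      · simp [h]
      · rw [hc, div_mul_cancel₀]; simpa using h
    have hwm : 2 * inner ℝ w m = ‖a‖ ^ 2 - ‖b‖ ^ 2 := by
      rw [hwdef, hm, inner_smul_right, inner_sub_left, inner_add_right, inner_add_right,
        real_inner_self_eq_norm_sq, real_inner_self_eq_norm_sq, real_inner_comm b a]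
      ring
    have hside : 2 * inner ℝ w (z + m) = ‖z + a‖ ^ 2 - ‖z + b‖ ^ 2 := by
      rw [inner_add_right, mul_add, hwm, norm_add_sq_real, norm_add_sq_real, hwdef,
        inner_sub_left, real_inner_comm z a, real_inner_comm z b]
      ring
    have hc0 : 0 ≤ c := by
      have : ‖z + b‖ ^ 2 ≤ ‖z + a‖ ^ 2 := by gcongr
      exact div_nonneg (by linarith) (by positivity)
    have hwm0 : inner ℝ w m ≤ 0 := by
      have : ‖a‖ ^ 2 ≤ ‖b‖ ^ 2 := by gcongr
      linarith
    have hsq : ‖z - (2 * c) • w‖ ^ 2 = ‖z‖ ^ 2 + 4 * (c * inner ℝ w m) := by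
      rw [norm_sub_sq_real, norm_smul, mul_pow, inner_smul_right, Real.norm_eq_abs, sq_abs,
        show (2 * c) ^ 2 * ‖w‖ ^ 2 = 4 * c * (c * ‖w‖ ^ 2) by ring, hcw, inner_add_right,
        real_inner_comm z w]
      ring
    have := mul_nonpos_of_nonneg_of_nonpos hc0 hwm0
    refine le_of_sq_le_sq ?_ (norm_nonneg _)
    simp only [hf]
    linarith

/-- A ball receives less standard Gaussian mass the farther its centre is from the origin. The
reflection exchanging the centres `-a` and `-b` carries the part of the second ball outside the
first onto the part of the first outside the second, and moves none of its points away from the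
origin; the density decreases with the distance from the origin. -/
lemma stdGaussian_ball_anti {ι : Type*} [Fintype ι] {a b : EuclideanSpace ℝ ι}
    (hab : ‖a‖ ≤ ‖b‖) (x : ℝ) :
    stdGaussian (EuclideanSpace ℝ ι) {z | ‖z + b‖ ^ 2 ≤ x} ≤
      stdGaussian (EuclideanSpace ℝ ι) {z | ‖z + a‖ ^ 2 ≤ x} := by
  obtain ⟨f, hf, hfa, hfb, hfn⟩ := exists_measurePreserving_swap a b hab
  set A : Set (EuclideanSpace ℝ ι) := {z | ‖z + a‖ ^ 2 ≤ x} with hA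
  set B : Set (EuclideanSpace ℝ ι) := {z | ‖z + b‖ ^ 2 ≤ x} with hB
  have mA : MeasurableSet A := measurableSet_le (by fun_prop) measurable_const
  have mB : MeasurableSet B := measurableSet_le (by fun_prop) measurable_const
  suffices h : stdGaussian (EuclideanSpace ℝ ι) (B \ A) ≤
      stdGaussian (EuclideanSpace ℝ ι) (A \ B) by
    rw [← measure_inter_add_sdiff B mA, ← measure_inter_add_sdiff A mB, Set.inter_comm B A]
    gcongr
  rw [stdGaussian_eq_withDensity, withDensity_apply _ (mB.diff mA),
    withDensity_apply _ (mA.diff mB), ← hf.setLIntegral_comp_preimage (mA.diff mB) (by fun_prop)]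
  have hpre : f ⁻¹' (A \ B) = B \ A := by
    ext z; simp [hA, hB, hfa, hfb]
  rw [hpre]
  refine setLIntegral_mono (by have := hf.measurable; fun_prop) fun z hz => ?_
  have hz' : ‖f z‖ ≤ ‖z‖ := by
    refine hfn z (le_of_lt ?_)
    have h1 : ‖z + b‖ ^ 2 ≤ x := hz.1
    have h2 : x < ‖z + a‖ ^ 2 := not_le.1 hz.2
    exact lt_of_pow_lt_pow_left₀ 2 (norm_nonneg _) (h1.trans_lt h2)
  gcongr

/-! ### The gamma and exponential distribution functions -/

lemma hasDerivAt_one_sub_exp_mul_sum (n : ℕ) (r x : ℝ) :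
    HasDerivAt (fun y => 1 - Real.exp (-(r * y)) *
        ∑ k ∈ Finset.range (n + 1), (r * y) ^ k / k.factorial)
      (r ^ (n + 1) / n.factorial * x ^ n * Real.exp (-(r * x))) x := by
  have hl : HasDerivAt (fun y : ℝ => r * y) r x := by simpa using (hasDerivAt_id x).const_mul r
  have he : HasDerivAt (fun y : ℝ => Real.exp (-(r * y))) (Real.exp (-(r * x)) * -r) x :=
    hl.neg.exp
  induction n with
  | zero =>
    simp only [zero_add, Finset.sum_range_one, pow_zero, Nat.factorial_zero, Nat.cast_one,
      div_one, mul_one, pow_one]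
    convert! he.const_sub 1 using 1
    ring
  | succ n ih =>
    have hp := (he.mul ((hl.pow (n + 1)).div_const ((n + 1).factorial : ℝ)))
    have hfun : (fun y => 1 - Real.exp (-(r * y)) *
        ∑ k ∈ Finset.range (n + 1 + 1), (r * y) ^ k / k.factorial) =
        (fun y => 1 - Real.exp (-(r * y)) *
          ∑ k ∈ Finset.range (n + 1), (r * y) ^ k / k.factorial) -
        ((fun y => Real.exp (-(r * y))) *
          fun y => (r * y) ^ (n + 1) / ((n + 1).factorial : ℝ)) := by
      funext y
      simp only [Pi.sub_apply, Pi.mul_apply]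
      rw [Finset.sum_range_succ _ (n + 1)]
      ring
    rw [hfun]
    convert! ih.sub hp using 1
    have h1 : ((n + 1).factorial : ℝ) = (n + 1) * n.factorial := by
      rw [Nat.factorial_succ]; push_cast; ring
    have h2 : (n.factorial : ℝ) ≠ 0 := by positivity
    have h3 : (n + 1 : ℝ) ≠ 0 := by positivity
    simp only [h1, Nat.add_sub_cancel, Pi.pow_apply]
    push_cast
    field_simp
    ring

/-- The distribution function of the gamma distribution with an integral shape (Erlang). -/
lemma cdf_gammaMeasure_nat {n : ℕ} (hn : 1 ≤ n) {r x : ℝ} (hr : 0 < r) (hx : 0 ≤ x) :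
    cdf (gammaMeasure n r) x =
      1 - Real.exp (-(r * x)) * ∑ k ∈ Finset.range n, (r * x) ^ k / k.factorial := by
  obtain ⟨n, rfl⟩ := Nat.exists_eq_add_of_le' hn
  have hpdf : gammaPDFReal (n + 1 : ℕ) r = Set.indicator (Set.Ici 0)
      fun y => r ^ (n + 1) / n.factorial * y ^ n * Real.exp (-(r * y)) := by
    funext y
    simp only [gammaPDFReal, Set.indicator_apply, Set.mem_Ici, Real.rpow_natCast,
      Nat.cast_succ, Real.Gamma_nat_eq_factorial, add_sub_cancel_right]
    norm_cast
  rw [cdf_gammaMeasure_eq_integral (by positivity) hr, hpdf,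
    setIntegral_indicator measurableSet_Ici, Set.inter_comm, Set.Ici_inter_Iic,
    integral_Icc_eq_integral_Ioc, ← intervalIntegral.integral_of_le hx,
    intervalIntegral.integral_eq_sub_of_hasDerivAt
      (fun y _ => hasDerivAt_one_sub_exp_mul_sum n r y)
      (Continuous.intervalIntegrable (by fun_prop) _ _)]
  simp [Finset.sum_range_succ']

/-- The distribution function of the gamma distribution with shape `n` and rate `1` is at most
`t ^ n / n!`, because its density at `y` is at most `y ^ (n - 1) / (n - 1)!`. -/
lemma one_sub_exp_mul_sum_le (n : ℕ) {t : ℝ} (ht : 0 ≤ t) :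
    1 - Real.exp (-t) * ∑ k ∈ Finset.range n, t ^ k / k.factorial ≤ t ^ n / n.factorial := by
  rcases n with _ | n
  · simp
  have hd : ∀ y : ℝ, HasDerivAt (fun y => y ^ (n + 1) / (n + 1).factorial -
      (1 - Real.exp (-(1 * y)) * ∑ k ∈ Finset.range (n + 1), (1 * y) ^ k / k.factorial))
      (y ^ n / n.factorial * (1 - Real.exp (-y))) y := by
    intro y
    convert! ((hasDerivAt_pow (n + 1) y).div_const ((n + 1).factorial : ℝ)).sub
      (hasDerivAt_one_sub_exp_mul_sum n 1 y) using 1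
    have h1 : ((n + 1).factorial : ℝ) = (n + 1) * n.factorial := by
      rw [Nat.factorial_succ]; push_cast; ring
    simp only [h1, Nat.add_sub_cancel]
    push_cast
    field_simp
    simp
  have hmono := monotoneOn_of_hasDerivWithinAt_nonneg (convex_Ici (0 : ℝ))
    (fun y _ => (hd y).continuousAt.continuousWithinAt) (fun y _ => (hd y).hasDerivWithinAt)
    fun y hy => by
      rw [interior_Ici] at hy
      have hy0 : 0 < y := hy
      have : Real.exp (-y) ≤ 1 := by simpa using hy0.le
      exact mul_nonneg (by positivity) (by linarith)
  have h := hmono Set.self_mem_Ici ht ht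
  simpa [Finset.sum_range_succ'] using h

/-- A gamma variable of integral shape `n` is at most `t` with probability at most that of `n`
independent exponential variables being at most `t`. In the induction step the distribution
function drops by `exp (-t) * t ^ n / n!`, which is at least `exp (-t)` times its value. -/
lemma one_sub_exp_mul_sum_le_pow (n : ℕ) {t : ℝ} (ht : 0 ≤ t) :
    1 - Real.exp (-t) * ∑ k ∈ Finset.range n, t ^ k / k.factorial ≤ (1 - Real.exp (-t)) ^ n := by
  induction n with
  | zero => simp
  | succ n ih =>
    have h1 : 0 ≤ 1 - Real.exp (-t) := by simpa using ht
    have h2 := one_sub_exp_mul_sum_le n ht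
    calc 1 - Real.exp (-t) * ∑ k ∈ Finset.range (n + 1), t ^ k / k.factorial
        = (1 - Real.exp (-t) * ∑ k ∈ Finset.range n, t ^ k / k.factorial) -
          Real.exp (-t) * (t ^ n / n.factorial) := by rw [Finset.sum_range_succ]; ring
      _ ≤ (1 - Real.exp (-t) * ∑ k ∈ Finset.range n, t ^ k / k.factorial) -
          Real.exp (-t) * (1 - Real.exp (-t) * ∑ k ∈ Finset.range n, t ^ k / k.factorial) := by
        gcongr
      _ = (1 - Real.exp (-t) * ∑ k ∈ Finset.range n, t ^ k / k.factorial) *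
          (1 - Real.exp (-t)) := by ring
      _ ≤ (1 - Real.exp (-t)) ^ n * (1 - Real.exp (-t)) := by gcongr
      _ = (1 - Real.exp (-t)) ^ (n + 1) := (pow_succ _ _).symm

/-! ### The non-central chi-squared distribution -/

lemma measurable_norm_add_sq {ι : Type*} [Fintype ι] (v : EuclideanSpace ℝ ι) :
    Measurable fun z : EuclideanSpace ℝ ι => ‖z + v‖ ^ 2 := by fun_prop

instance isProbabilityMeasure_noncentralChiSq (k : ℕ) (nc : ℝ) :
    IsProbabilityMeasure (noncentralChiSq k nc) :=
  Measure.isProbabilityMeasure_map (measurable_norm_add_sq _).aemeasurable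

lemma cdf_noncentralChiSq (k : ℕ) (nc x : ℝ) :
    cdf (noncentralChiSq k nc) x = (stdGaussian (EuclideanSpace ℝ (Fin k))).real
      {z | ‖z + WithLp.toLp 2 (fun _ : Fin k => √(nc / k))‖ ^ 2 ≤ x} := by
  rw [cdf_eq_real, noncentralChiSq,
    map_measureReal_apply (measurable_norm_add_sq _) measurableSet_Iic]
  rfl

lemma norm_toLp_const_sqrt_div {k : ℕ} (nc : ℝ) :
    ‖(WithLp.toLp 2 (fun _ : Fin k => √(nc / k)) : EuclideanSpace ℝ (Fin k))‖ ^ 2 =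
      k * √(nc / k) ^ 2 := by
  simp [EuclideanSpace.real_norm_sq_eq]

/-- The non-central chi-squared distribution is stochastically increasing in the non-centrality.
No sign condition is needed: for negative `nc` the centre `√(nc / k)` is `0`. -/
lemma cdf_noncentralChiSq_anti (k : ℕ) (x : ℝ) :
    Antitone fun nc => cdf (noncentralChiSq k nc) x := by
  intro a b hab
  simp only [cdf_noncentralChiSq]
  refine ENNReal.toReal_mono (measure_ne_top _ _) (stdGaussian_ball_anti ?_ x)
  refine le_of_sq_le_sq ?_ (norm_nonneg _)
  rw [norm_toLp_const_sqrt_div, norm_toLp_const_sqrt_div]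
  gcongr

/-- The distribution of `‖z + v‖ ^ 2` for a standard Gaussian `z` depends on `v` through its norm
only. -/
lemma cdf_noncentralChiSq_norm_sq {k : ℕ} (hk : 1 ≤ k) (v : EuclideanSpace ℝ (Fin k)) (x : ℝ) :
    cdf (noncentralChiSq k (‖v‖ ^ 2)) x =
      (stdGaussian (EuclideanSpace ℝ (Fin k))).real {z | ‖z + v‖ ^ 2 ≤ x} := by
  have hk0 : (0 : ℝ) < k := by exact_mod_cast hk
  have hn : ‖(WithLp.toLp 2 (fun _ : Fin k => √(‖v‖ ^ 2 / k)) : EuclideanSpace ℝ (Fin k))‖ =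
      ‖v‖ := by
    refine (sq_eq_sq₀ (norm_nonneg _) (norm_nonneg _)).1 ?_
    rw [norm_toLp_const_sqrt_div, Real.sq_sqrt (by positivity)]
    field_simp
  rw [cdf_noncentralChiSq, measureReal_def, measureReal_def]
  exact congrArg ENNReal.toReal
    (le_antisymm (stdGaussian_ball_anti hn.ge x) (stdGaussian_ball_anti hn.le x))

lemma multivariateGaussian_zero_sq_smul_one {ι : Type*} [Fintype ι] [DecidableEq ι] (σ : ℝ) :
    multivariateGaussian 0 (σ ^ 2 • (1 : Matrix ι ι ℝ)) =
      (stdGaussian (EuclideanSpace ℝ ι)).map fun z => σ • z := by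
  have hps : (σ ^ 2 • (1 : Matrix ι ι ℝ)).PosSemidef := Matrix.PosSemidef.one.smul (sq_nonneg σ)
  refine Measure.ext_of_charFun ?_
  ext t
  rw [charFun_multivariateGaussian hps, charFun_map_smul, charFun_stdGaussian, norm_smul,
    ← Complex.ofReal_pow, mul_pow, EuclideanSpace.real_norm_sq_eq]
  simp [Matrix.smul_mulVec, dotProduct, pow_two, neg_div, Finset.mul_sum, mul_assoc, mul_left_comm]

/-- `scaledNCChiSqCDF σ v` is the distribution function of `‖v + e‖ ^ 2` for `e ∼ N(0, σ² I)`. -/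
lemma scaledNCChiSqCDF_eq {p : ℕ} (hp : 1 ≤ p) {σ : ℝ} (hσ : 0 < σ)
    (v : EuclideanSpace ℝ (Fin p)) (x : ℝ) :
    scaledNCChiSqCDF σ v x =
      (multivariateGaussian 0 (σ ^ 2 • (1 : Matrix (Fin p) (Fin p) ℝ))).real
        {e | ‖v + e‖ ^ 2 ≤ x} := by
  have hv : ‖v‖ ^ 2 / σ ^ 2 = ‖σ⁻¹ • v‖ ^ 2 := by
    rw [norm_smul, Real.norm_of_nonneg (by positivity)]; field_simp
  rw [scaledNCChiSqCDF, hv, cdf_noncentralChiSq_norm_sq hp,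
    multivariateGaussian_zero_sq_smul_one,
    map_measureReal_apply (by fun_prop) (measurableSet_le (by fun_prop) measurable_const)]
  congr 1
  ext z
  have : v + σ • z = σ • (z + σ⁻¹ • v) := by
    rw [smul_add, smul_inv_smul₀ hσ.ne', add_comm]
  simp only [Set.mem_ofPred_eq, Set.preimage_ofPred_eq, this, norm_smul, mul_pow,
    Real.norm_eq_abs, sq_abs]
  rw [le_div_iff₀ (by positivity), mul_comm]

lemma scaledNCChiSqCDF_anti {p : ℕ} (σ : ℝ) {v w : EuclideanSpace ℝ (Fin p)}
    (h : ‖v‖ ≤ ‖w‖) (x : ℝ) : scaledNCChiSqCDF σ w x ≤ scaledNCChiSqCDF σ v x :=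
  cdf_noncentralChiSq_anti _ _ (by gcongr)

lemma scaledNCChiSqCDF_mono {p : ℕ} (σ : ℝ) (v : EuclideanSpace ℝ (Fin p)) :
    Monotone (scaledNCChiSqCDF σ v) := fun x y h =>
  monotone_cdf _ (by gcongr)

lemma measurable_scaledNCChiSqCDF {p : ℕ} (hp : 1 ≤ p) {σ : ℝ} (hσ : 0 < σ) :
    Measurable fun q : EuclideanSpace ℝ (Fin p) × ℝ => scaledNCChiSqCDF σ q.1 q.2 := by
  simp only [scaledNCChiSqCDF_eq hp hσ, measureReal_def]
  refine (measurable_measure_prodMk_left (s := {u : (EuclideanSpace ℝ (Fin p) × ℝ) ×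
    EuclideanSpace ℝ (Fin p) | ‖u.1.1 + u.2‖ ^ 2 ≤ u.1.2}) ?_).ennreal_toReal
  exact measurableSet_le (by fun_prop) (by fun_prop)

/-- The upper quantile increases with the non-centrality; this gives its measurability. The level
lies strictly between `0` and `1`, so that the sets in the definition of `upperQuantile` are
non-empty and bounded below. -/
lemma upperQuantile_noncentralChiSq_mono (k : ℕ) {a : ℝ} (ha0 : 0 < a) (ha1 : a < 1) :
    Monotone fun nc => upperQuantile (noncentralChiSq k nc) a := by
  intro c c' hcc
  refine csInf_le_csInf ?_ ?_ fun x hx => ?_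
  · obtain ⟨y, hy⟩ := ((tendsto_cdf_atBot (noncentralChiSq k c)).eventually
      (gt_mem_nhds (sub_pos.2 ha1))).exists
    refine ⟨y, fun x (hx : 1 - _ ≤ a) => ?_⟩
    by_contra! hlt
    have := monotone_cdf (noncentralChiSq k c) hlt.le
    linarith
  · obtain ⟨y, hy⟩ := ((tendsto_cdf_atTop (noncentralChiSq k c')).eventually
      (lt_mem_nhds (sub_lt_self 1 ha0))).exists
    exact ⟨y, show 1 - _ ≤ a by linarith⟩
  · have := cdf_noncentralChiSq_anti k x hcc
    have hx' : 1 - cdf (noncentralChiSq k c') x ≤ a := hx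
    exact show 1 - cdf (noncentralChiSq k c) x ≤ a by linarith

/-! ### Conditioning on an independent variable -/

/-- The conditional probability, given `X`, of an event on `(X, Y)` with `Y` independent of `X`: fix
the value of `X` and integrate over the law of `Y`. -/
lemma condExp_indicator_prod_of_indepFun {Ω β γ : Type*} [MeasurableSpace Ω] {P : Measure Ω}
    [IsProbabilityMeasure P] [mβ : MeasurableSpace β] [MeasurableSpace γ] [StandardBorelSpace γ]
    [Nonempty γ] {X : Ω → β} {Y : Ω → γ} (hX : Measurable X) (hY : Measurable Y)
    (h : IndepFun Y X P) {s : Set (β × γ)} (hs : MeasurableSet s) :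
    P⟦{ω | (X ω, Y ω) ∈ s} | mβ.comap X⟧ =ᵐ[P] fun ω => (P.map Y).real {y | (X ω, y) ∈ s} := by
  have hker : condDistrib Y X P =ᵐ[P.map X] Kernel.const β (P.map Y) := by
    refine condDistrib_ae_eq_of_measure_eq_compProd X hY.aemeasurable ?_
    rw [Measure.compProd_const]
    exact (indepFun_iff_map_prod_eq_prod_map_map hX.aemeasurable hY.aemeasurable).1 h.symm
  have hf : StronglyMeasurable (s.indicator fun _ : β × γ => (1 : ℝ)) :=
    stronglyMeasurable_const.indicator hs
  have hint : Integrable (fun ω => s.indicator (fun _ : β × γ => (1 : ℝ)) (X ω, Y ω)) P :=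
    (integrable_const (1 : ℝ)).indicator (hX.prodMk hY hs)
  filter_upwards [condExp_prod_ae_eq_integral_condDistrib hX hY.aemeasurable hf hint,
    ae_of_ae_map hX.aemeasurable hker] with ω h1 h2
  refine h1.trans ?_
  rw [h2, Kernel.const_apply]
  exact integral_indicator_one (measurable_prodMk_left hs)

/-- An upper bound for a conditional probability on an event of the conditioning `σ`-algebra
yields a bound for the elementary conditional probability given that event. -/
lemma cond_real_le_integral_of_condExp_le {Ω : Type*} {m m₀ : MeasurableSpace Ω}
    {P : Measure Ω} [IsProbabilityMeasure P] (hm : m ≤ m₀) {s t : Set Ω}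
    (hs : MeasurableSet[m] s) (ht : MeasurableSet t) {f : Ω → ℝ} (hf : Integrable f P)
    (h : ∀ᵐ ω ∂P, ω ∈ s → (P⟦t | m⟧) ω ≤ f ω) :
    (cond P s).real t ≤ ∫ ω, f ω ∂(cond P s) := by
  have hint : Integrable (t.indicator fun _ => (1 : ℝ)) P := (integrable_const 1).indicator ht
  have hle : P.real (s ∩ t) ≤ ∫ ω in s, f ω ∂P := by
    calc P.real (s ∩ t) = ∫ ω in s, t.indicator (fun _ => (1 : ℝ)) ω ∂P := by
          rw [setIntegral_indicator ht]; simp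
      _ = ∫ ω in s, (P⟦t | m⟧) ω ∂P := (setIntegral_condExp hm hint hs).symm
      _ ≤ ∫ ω in s, f ω ∂P :=
        setIntegral_mono_on_ae integrable_condExp.integrableOn hf.integrableOn (hm s hs) h
  rw [measureReal_def, cond_apply (hm s hs), ENNReal.toReal_mul, ProbabilityTheory.cond,
    integral_smul_measure, smul_eq_mul, ← measureReal_def]
  gcongr

/-! ### The sequential privacy scheme -/

lemma measurable_perturbedScale (t : EigenTarget) (l : ℝ) : Measurable (perturbedScale t l) := by
  cases t <;> unfold perturbedScale <;> fun_prop

lemma measurable_scaledScores {α : Type*} [MeasurableSpace α] {p d : ℕ} (h : p ≤ d)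
    {W : α → Matrix (Fin d) (Fin d) ℝ} (hW : ∀ i j, Measurable fun a => W a i j)
    {s : α → Fin d → ℝ} (hs : ∀ i, Measurable fun a => s a i)
    {u : α → EuclideanSpace ℝ (Fin d)} (hu : Measurable u) :
    Measurable fun a => scaledScores h (W a) (s a) (u a) := by
  refine (WithLp.measurable_toLp 2 _).comp (measurable_pi_lambda _ fun i => ?_)
  refine (hs _).mul ?_
  simp only [Matrix.mulVec, dotProduct, Matrix.transpose_apply]
  exact Finset.measurable_sum _ fun j _ => (hW _ _).mul (by fun_prop)

lemma alarmOf_eq_one_iff (s t : ℝ) : alarmOf s t = 1 ↔ t < s := by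
  simp [alarmOf]

lemma alarmOf_eq_zero_iff (s t : ℝ) : alarmOf s t = 0 ↔ s ≤ t := by
  simp [alarmOf]

lemma alarmOf_eq_one_iff_ne_zero (s t : ℝ) : alarmOf s t = 1 ↔ alarmOf s t ≠ 0 := by
  simp [alarmOf]

namespace SequentialPrivacyScheme

variable {Ω : Type*} [MeasurableSpace Ω] {P : Measure Ω} {p d : ℕ}
  (M : SequentialPrivacyScheme P p d)

lemma theta_nonneg : 0 ≤ M.theta := by
  have hd : (1 : ℝ) ≤ d := by exact_mod_cast M.one_le_p.trans M.p_le_d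
  refine mul_nonneg (div_pos M.sens_pos M.epsCov_pos).le (Real.log_nonneg ?_)
  rw [one_le_div M.gamCov_pos]
  exact M.gamCov_lt_one.le.trans hd

lemma measurable_tauCov : Measurable M.tauCov :=
  measurable_scaledScores _ M.VHat_measurable
    (fun i => (measurable_perturbedScale _ _).comp (M.ξ_measurable i)) M.r_measurable

lemma measurable_residual_tauCov : Measurable fun ω => (M.r ω, M.tauCov ω) :=
  M.r_measurable.prodMk M.measurable_tauCov

lemma given_le : M.given ≤ (inferInstance : MeasurableSpace Ω) :=
  M.measurable_residual_tauCov.comap_le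

lemma measurable_T : Measurable M.T := by
  have h : Measurable M.tau := measurable_scaledScores (W := fun _ => M.V)
      (s := fun _ i => (√(M.lam i))⁻¹) _ (fun _ _ => measurable_const)
    (fun _ => measurable_const) M.r_measurable
  unfold T
  fun_prop

lemma measurable_ncThreshold_of_norm_sq :
    Measurable fun v : EuclideanSpace ℝ (Fin p) =>
      upperQuantile (noncentralChiSq p (‖v‖ ^ 2)) M.αHat :=
  (upperQuantile_noncentralChiSq_mono p M.αHat_pos M.αHat_lt_one).measurable.comp (by fun_prop)

lemma measurable_ncThreshold : Measurable M.ncThreshold :=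
  M.measurable_ncThreshold_of_norm_sq.comp M.measurable_tauCov

lemma measurable_THat : Measurable M.THat :=
  (M.measurable_T.add (M.measurable_ncThreshold.const_mul _)).sub_const _

lemma measurable_F : Measurable fun q : EuclideanSpace ℝ (Fin p) × ℝ => M.F q.1 q.2 :=
  measurable_scaledNCChiSqCDF M.one_le_p M.σ_pos

lemma measurable_F_comp {v : Ω → EuclideanSpace ℝ (Fin p)} (hv : Measurable v) {x : Ω → ℝ}
    (hx : Measurable x) : Measurable fun ω => M.F (v ω) (x ω) := by
  have := M.measurable_F.comp (hv.prodMk hx)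
  exact this

lemma F_nonneg (v : EuclideanSpace ℝ (Fin p)) (x : ℝ) : 0 ≤ M.F v x := cdf_nonneg _ _

lemma F_le_one (v : EuclideanSpace ℝ (Fin p)) (x : ℝ) : M.F v x ≤ 1 := cdf_le_one _ _

lemma rho_eq_one_iff (ω : Ω) : M.rho ω = 1 ↔ M.chiThreshold < M.T ω := alarmOf_eq_one_iff _ _

lemma rho_eq_zero_iff (ω : Ω) : M.rho ω = 0 ↔ M.T ω ≤ M.chiThreshold := alarmOf_eq_zero_iff _ _

lemma rhoHat_eq_zero_iff (ω : Ω) :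
    M.rhoHat ω = 0 ↔ ‖M.tauCov ω + M.e ω‖ ^ 2 ≤ M.σ ^ 2 * M.ncThreshold ω :=
  alarmOf_eq_zero_iff _ _

lemma indepFun_e_residual_tauCov : IndepFun M.e (fun ω => (M.r ω, M.tauCov ω)) P := by
  have hg : Measurable fun q : EuclideanSpace ℝ (Fin d) × (Fin d → Fin d → ℝ) × (Fin d → ℝ) =>
      (q.1, scaledScores M.p_le_d (Matrix.of q.2.1)
        (fun i => perturbedScale M.target (M.lam i) (q.2.2 i)) q.1) := by
    refine measurable_fst.prodMk (measurable_scaledScores _ (fun i j => ?_) (fun i => ?_)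
      measurable_fst)
    · simp only [Matrix.of_apply]; fun_prop
    · exact (measurable_perturbedScale _ _).comp (by fun_prop)
  exact M.e_indep.comp measurable_id hg

lemma measurableSet_rhoHat_eq_zero : MeasurableSet {ω | M.rhoHat ω = 0} := by
  simp only [rhoHat_eq_zero_iff]
  exact measurableSet_le ((M.measurable_tauCov.add M.e_measurable).norm.pow_const 2)
    (M.measurable_ncThreshold.const_mul _)

lemma setOf_rhoHat_eq_one : {ω | M.rhoHat ω = 1} = {ω | M.rhoHat ω = 0}ᶜ :=
  Set.ext fun _ => alarmOf_eq_one_iff_ne_zero _ _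

lemma R_nonneg (b : OrthonormalBasis (Fin d) ℝ (EuclideanSpace ℝ (Fin d))) (ω : Ω) :
    0 ≤ M.R b ω := Finset.sum_nonneg fun _ _ => sq_nonneg _

lemma R_le (b : OrthonormalBasis (Fin d) ℝ (EuclideanSpace ℝ (Fin d))) (ω : Ω) :
    M.R b ω ≤ ‖M.r ω‖ ^ 2 := by
  rw [← b.repr.norm_map (M.r ω), EuclideanSpace.real_norm_sq_eq]
  have := Finset.sum_le_sum_of_subset_of_nonneg
    (Finset.subset_univ (Finset.univ.map (Fin.castLEEmb M.p_le_d)))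
    (fun i _ _ => sq_nonneg (b.repr (M.r ω) i))
  simpa [R] using this

lemma measurable_R (b : OrthonormalBasis (Fin d) ℝ (EuclideanSpace ℝ (Fin d))) :
    Measurable (M.R b) := by
  have := M.r_measurable
  have hb : Measurable b.repr := b.repr.continuous.measurable
  unfold R
  fun_prop

lemma weightOne_nonneg (b : OrthonormalBasis (Fin d) ℝ (EuclideanSpace ℝ (Fin d)))
    (rmax : Ω → EuclideanSpace ℝ (Fin d)) (ω : Ω) : 0 ≤ M.weightOne b rmax ω :=
  sub_nonneg.2 (cdf_le_one _ _)

lemma weightOne_le_one (b : OrthonormalBasis (Fin d) ℝ (EuclideanSpace ℝ (Fin d)))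
    (rmax : Ω → EuclideanSpace ℝ (Fin d)) (ω : Ω) : M.weightOne b rmax ω ≤ 1 :=
  sub_le_self _ (cdf_nonneg _ _)

lemma weightTwo_nonneg : 0 ≤ M.weightTwo := pow_nonneg (cdf_nonneg _ _) _

lemma weightTwo_le_one : M.weightTwo ≤ 1 := pow_le_one₀ (cdf_nonneg _ _) (cdf_le_one _ _)

/-- A closed form of the weight `ω₁`. It fails when `rmax ω = 0`: there the division by zero makes
the rate of the gamma measure `0`. -/
lemma weightOne_eq (b : OrthonormalBasis (Fin d) ℝ (EuclideanSpace ℝ (Fin d)))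
    {rmax : Ω → EuclideanSpace ℝ (Fin d)} {ω : Ω} (h : rmax ω ≠ 0) :
    M.weightOne b rmax ω =
      Real.exp (-(M.epsCov / (M.sens * ‖rmax ω‖ ^ 2) * (M.R b ω * M.theta))) *
        ∑ k ∈ Finset.range p,
          (M.epsCov / (M.sens * ‖rmax ω‖ ^ 2) * (M.R b ω * M.theta)) ^ k / k.factorial := by
  have hr : 0 < ‖rmax ω‖ := norm_pos_iff.2 h
  have hrate : 0 < M.epsCov / (M.sens * ‖rmax ω‖ ^ 2) :=
    div_pos M.epsCov_pos (mul_pos M.sens_pos (by positivity))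
  rw [weightOne, cdf_gammaMeasure_nat M.one_le_p hrate
    (mul_nonneg (M.R_nonneg b ω) M.theta_nonneg)]
  ring

lemma aemeasurable_weightOne (b : OrthonormalBasis (Fin d) ℝ (EuclideanSpace ℝ (Fin d)))
    {rmax : Ω → EuclideanSpace ℝ (Fin d)} (hrmax : Measurable rmax)
    (hne : ∀ᵐ ω ∂P, rmax ω ≠ 0) : AEMeasurable (M.weightOne b rmax) P := by
  refine AEMeasurable.congr (Measurable.aemeasurable ?_)
    (hne.mono fun ω h => (M.weightOne_eq b h).symm)
  have := M.measurable_R b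
  fun_prop

/-- The two weights sum to at least one. As `R ≤ ‖rmax‖ ^ 2`, the gamma probability in `ω₁` is at
most the probability that a sum of `p` independent exponential variables is at most `θ`, and the
sum is at most `θ` only if each of the variables is. -/
lemma one_le_weightOne_add_weightTwo
    (b : OrthonormalBasis (Fin d) ℝ (EuclideanSpace ℝ (Fin d)))
    {rmax : Ω → EuclideanSpace ℝ (Fin d)} {ω : Ω} (h : rmax ω ≠ 0) (hle : ‖M.r ω‖ ≤ ‖rmax ω‖) :
    1 ≤ M.weightOne b rmax ω + M.weightTwo := by
  have hr : 0 < ‖rmax ω‖ := norm_pos_iff.2 h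
  have hθ := M.theta_nonneg
  have hs := M.sens_pos
  have hε := M.epsCov_pos
  have hR := M.R_nonneg b ω
  set t := M.epsCov / (M.sens * ‖rmax ω‖ ^ 2) * (M.R b ω * M.theta) with ht
  have ht0 : 0 ≤ t := by positivity
  have htle : t ≤ M.epsCov / M.sens * M.theta := by
    have hRle : M.R b ω ≤ ‖rmax ω‖ ^ 2 := (M.R_le b ω).trans (by gcongr)
    calc t = M.epsCov / M.sens * M.theta * (M.R b ω / ‖rmax ω‖ ^ 2) := by
          rw [ht]; field_simp
      _ ≤ M.epsCov / M.sens * M.theta * 1 := by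
          gcongr
          exact (div_le_one (by positivity)).2 hRle
      _ = _ := mul_one _
  have h1 : 1 - Real.exp (-t) * ∑ k ∈ Finset.range p, t ^ k / k.factorial ≤ M.weightTwo := by
    rw [weightTwo, cdf_expMeasure_eq (by positivity), if_pos hθ]
    refine (one_sub_exp_mul_sum_le_pow p ht0).trans ?_
    have : 0 ≤ 1 - Real.exp (-t) := by simpa using ht0
    gcongr
  rw [M.weightOne_eq b h, ← ht]
  linarith

lemma measurableSet_rho_eq_zero : MeasurableSet[M.given] {ω | M.rho ω = 0} := by
  have htau : Measurable fun q : EuclideanSpace ℝ (Fin d) × EuclideanSpace ℝ (Fin p) =>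
      scaledScores M.p_le_d M.V (fun i => (√(M.lam i))⁻¹) q.1 :=
    measurable_scaledScores (W := fun _ => M.V)
      (s := fun _ i => (√(M.lam i))⁻¹) _ (fun _ _ => measurable_const) (fun _ => measurable_const)
      measurable_fst
  have hT : Measurable fun q : EuclideanSpace ℝ (Fin d) × EuclideanSpace ℝ (Fin p) =>
      ‖scaledScores M.p_le_d M.V (fun i => (√(M.lam i))⁻¹) q.1‖ ^ 2 := by fun_prop
  simp only [rho_eq_zero_iff]
  exact ⟨_, measurableSet_le hT (measurable_const (a := M.chiThreshold)), rfl⟩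

lemma measurableSet_rho_eq_one : MeasurableSet[M.given] {ω | M.rho ω = 1} := by
  have : {ω | M.rho ω = 1} = {ω | M.rho ω = 0}ᶜ :=
    Set.ext fun _ => alarmOf_eq_one_iff_ne_zero _ _
  rw [this]
  exact M.measurableSet_rho_eq_zero.compl

variable [IsProbabilityMeasure P]

/-- Given the residual and `τ̂^cov`, the only randomness left in the regulator's statistic is the
Gaussian noise. -/
lemma condProb_rhoHat_eq_zero :
    P⟦{ω | M.rhoHat ω = 0} | M.given⟧ =ᵐ[P]
      fun ω => M.F (M.tauCov ω) (M.σ ^ 2 * M.ncThreshold ω) := by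
  have hs : MeasurableSet {q : (EuclideanSpace ℝ (Fin d) × EuclideanSpace ℝ (Fin p)) ×
      EuclideanSpace ℝ (Fin p) | ‖q.1.2 + q.2‖ ^ 2 ≤
        M.σ ^ 2 * upperQuantile (noncentralChiSq p (‖q.1.2‖ ^ 2)) M.αHat} :=
    measurableSet_le (by fun_prop)
      ((M.measurable_ncThreshold_of_norm_sq.comp (by fun_prop)).const_mul _)
  have h := condExp_indicator_prod_of_indepFun M.measurable_residual_tauCov M.e_measurable
    M.indepFun_e_residual_tauCov hs
  rw [M.e_law.map_eq] at h
  simp only [rhoHat_eq_zero_iff]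
  refine h.trans (ae_of_all _ fun ω => ?_)
  exact (scaledNCChiSqCDF_eq M.one_le_p M.σ_pos (M.tauCov ω) (M.σ ^ 2 * M.ncThreshold ω)).symm

lemma condProb_rhoHat_eq_one :
    P⟦{ω | M.rhoHat ω = 1} | M.given⟧ =ᵐ[P]
      fun ω => 1 - M.F (M.tauCov ω) (M.σ ^ 2 * M.ncThreshold ω) := by
  have hsub : ({ω | M.rhoHat ω = 1}.indicator fun _ => (1 : ℝ)) =
      (fun _ => (1 : ℝ)) - {ω | M.rhoHat ω = 0}.indicator fun _ => (1 : ℝ) := by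
    rw [setOf_rhoHat_eq_one, Set.indicator_compl]
  rw [hsub]
  filter_upwards [condExp_sub (integrable_const (1 : ℝ))
    ((integrable_const (1 : ℝ)).indicator M.measurableSet_rhoHat_eq_zero) M.given (μ := P),
    M.condProb_rhoHat_eq_zero] with ω h1 h2
  rw [h1, Pi.sub_apply, h2, condExp_const M.given_le]

lemma integrable_falseAlarmBound (b : OrthonormalBasis (Fin d) ℝ (EuclideanSpace ℝ (Fin d)))
    {rmax : Ω → EuclideanSpace ℝ (Fin d)} (hrmax : Measurable rmax)
    (hne : ∀ᵐ ω ∂P, rmax ω ≠ 0) {tauMax : Ω → EuclideanSpace ℝ (Fin p)}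
    (htauMax : Measurable tauMax) : Integrable (M.falseAlarmBound b rmax tauMax) P := by
  have hF := M.measurable_F_comp M.measurable_tauCov M.measurable_THat
  have hF' := M.measurable_F_comp htauMax M.measurable_THat
  refine Integrable.of_bound (C := 2) (((M.aemeasurable_weightOne b hrmax hne).mul
    (hF.const_sub 1).aemeasurable).add
      ((hF'.const_sub 1).const_mul _).aemeasurable).aestronglyMeasurable (ae_of_all _ fun ω => ?_)
  have h1 := M.weightOne_nonneg b rmax ω
  have h2 := M.weightTwo_nonneg
  have h3 := sub_nonneg.2 (M.F_le_one (M.tauCov ω) (M.THat ω))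
  have h4 := sub_nonneg.2 (M.F_le_one (tauMax ω) (M.THat ω))
  have h5 := mul_le_one₀ (M.weightOne_le_one b rmax ω) h3
    (sub_le_self _ (M.F_nonneg (M.tauCov ω) (M.THat ω)))
  have h6 := mul_le_one₀ M.weightTwo_le_one h4 (sub_le_self _ (M.F_nonneg (tauMax ω) (M.THat ω)))
  rw [falseAlarmBound, Real.norm_of_nonneg (add_nonneg (mul_nonneg h1 h3) (mul_nonneg h2 h4))]
  linarith

lemma integrable_missedAlarmBound (b : OrthonormalBasis (Fin d) ℝ (EuclideanSpace ℝ (Fin d)))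
    {rmax : Ω → EuclideanSpace ℝ (Fin d)} (hrmax : Measurable rmax)
    (hne : ∀ᵐ ω ∂P, rmax ω ≠ 0) : Integrable (M.missedAlarmBound b rmax) P := by
  have hF := M.measurable_F_comp M.measurable_tauCov M.measurable_THat
  refine Integrable.of_bound (C := 2) (hF.aemeasurable.mul
    ((M.aemeasurable_weightOne b hrmax hne).add_const _)).aestronglyMeasurable
      (ae_of_all _ fun ω => ?_)
  have h1 := M.weightOne_nonneg b rmax ω
  have h2 := M.weightTwo_nonneg
  have h3 := M.weightOne_le_one b rmax ω
  have h4 := M.weightTwo_le_one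
  have h5 := M.F_nonneg (M.tauCov ω) (M.THat ω)
  rw [missedAlarmBound, Real.norm_of_nonneg (mul_nonneg h5 (add_nonneg h1 h2))]
  calc _ ≤ 1 * (M.weightOne b rmax ω + M.weightTwo) :=
        mul_le_mul_of_nonneg_right (M.F_le_one _ _) (add_nonneg h1 h2)
    _ ≤ 2 := by linarith

/-- Where the utility raises no alarm, `T̂` is at most the regulator's threshold, so both tails in
the bound are at least the conditional probability of a false alarm. -/
lemma condProb_rhoHat_eq_one_le (b : OrthonormalBasis (Fin d) ℝ (EuclideanSpace ℝ (Fin d)))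
    {rmax : Ω → EuclideanSpace ℝ (Fin d)} (hne : ∀ᵐ ω ∂P, rmax ω ≠ 0)
    (hr : ∀ ω, ‖M.r ω‖ ≤ ‖rmax ω‖) {tauMax : Ω → EuclideanSpace ℝ (Fin p)}
    (htau : ∀ ω, ‖M.tauCov ω‖ ≤ ‖tauMax ω‖) :
    ∀ᵐ ω ∂P, M.rho ω = 0 →
      (P⟦{ω' | M.rhoHat ω' = 1} | M.given⟧) ω ≤ M.falseAlarmBound b rmax tauMax ω := by
  filter_upwards [M.condProb_rhoHat_eq_one, hne] with ω hω hω0 hrho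
  rw [hω]
  have hT : M.THat ω ≤ M.σ ^ 2 * M.ncThreshold ω := by
    have := (M.rho_eq_zero_iff ω).1 hrho
    rw [THat]
    linarith
  have h1 : M.F (M.tauCov ω) (M.THat ω) ≤ M.F (M.tauCov ω) (M.σ ^ 2 * M.ncThreshold ω) :=
    scaledNCChiSqCDF_mono _ _ hT
  have h2 : M.F (tauMax ω) (M.THat ω) ≤ M.F (M.tauCov ω) (M.THat ω) :=
    scaledNCChiSqCDF_anti _ (htau ω) _
  have hw := M.one_le_weightOne_add_weightTwo b hω0 (hr ω)
  have h3 := sub_nonneg.2 (M.F_le_one (M.tauCov ω) (M.THat ω))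
  calc 1 - M.F (M.tauCov ω) (M.σ ^ 2 * M.ncThreshold ω)
      ≤ 1 * (1 - M.F (M.tauCov ω) (M.THat ω)) := by linarith
    _ ≤ (M.weightOne b rmax ω + M.weightTwo) * (1 - M.F (M.tauCov ω) (M.THat ω)) := by gcongr
    _ = M.weightOne b rmax ω * (1 - M.F (M.tauCov ω) (M.THat ω)) +
        M.weightTwo * (1 - M.F (M.tauCov ω) (M.THat ω)) := add_mul _ _ _
    _ ≤ M.falseAlarmBound b rmax tauMax ω := by
      have := M.weightTwo_nonneg
      rw [falseAlarmBound]
      gcongr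

/-- Where the utility raises an alarm, `T̂` exceeds the regulator's threshold. -/
lemma condProb_rhoHat_eq_zero_le (b : OrthonormalBasis (Fin d) ℝ (EuclideanSpace ℝ (Fin d)))
    {rmax : Ω → EuclideanSpace ℝ (Fin d)} (hne : ∀ᵐ ω ∂P, rmax ω ≠ 0)
    (hr : ∀ ω, ‖M.r ω‖ ≤ ‖rmax ω‖) :
    ∀ᵐ ω ∂P, M.rho ω = 1 →
      (P⟦{ω' | M.rhoHat ω' = 0} | M.given⟧) ω ≤ M.missedAlarmBound b rmax ω := by
  filter_upwards [M.condProb_rhoHat_eq_zero, hne] with ω hω hω0 hrho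
  rw [hω]
  have hT : M.σ ^ 2 * M.ncThreshold ω ≤ M.THat ω := by
    have := (M.rho_eq_one_iff ω).1 hrho
    rw [THat]
    linarith
  calc M.F (M.tauCov ω) (M.σ ^ 2 * M.ncThreshold ω)
      ≤ M.F (M.tauCov ω) (M.THat ω) := scaledNCChiSqCDF_mono _ _ hT
    _ ≤ M.missedAlarmBound b rmax ω :=
      le_mul_of_one_le_right (M.F_nonneg _ _) (M.one_le_weightOne_add_weightTwo b hω0 (hr ω))

end SequentialPrivacyScheme

theorem mainTheorem2 {Ω : Type*} [MeasurableSpace Ω] (P : Measure Ω) [IsProbabilityMeasure P]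
    {p d : ℕ} (M : SequentialPrivacyScheme P p d)
    (b : OrthonormalBasis (Fin d) ℝ (EuclideanSpace ℝ (Fin d)))
    (resSet : Ω → Set (EuclideanSpace ℝ (Fin d))) (hres : ∀ ω, M.r ω ∈ resSet ω)
    (rmax : Ω → EuclideanSpace ℝ (Fin d)) (hrmax_meas : Measurable rmax)
    (hrmax_mem : ∀ ω, rmax ω ∈ resSet ω)
    (hrmax : ∀ ω, IsMaxOn (fun u => ‖u‖) (resSet ω) (rmax ω))
    (hrmax_ne : ∀ᵐ ω ∂P, rmax ω ≠ 0)
    (tauSet : Ω → Set (EuclideanSpace ℝ (Fin p))) (htau : ∀ ω, M.tauCov ω ∈ tauSet ω)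
    (tauMax : Ω → EuclideanSpace ℝ (Fin p)) (htauMax_meas : Measurable tauMax)
    (htauMax_mem : ∀ ω, tauMax ω ∈ tauSet ω)
    (htauMax : ∀ ω, IsMaxOn (fun v => ‖v‖) (tauSet ω) (tauMax ω)) :
    (∀ᵐ ω ∂P, M.rho ω = 0 →
      (P⟦{ω' | M.rhoHat ω' = 1} | M.given⟧) ω ≤ M.falseAlarmBound b rmax tauMax ω) ∧
    (∀ᵐ ω ∂P, M.rho ω = 1 →
      (P⟦{ω' | M.rhoHat ω' = 0} | M.given⟧) ω ≤ M.missedAlarmBound b rmax ω) ∧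
    (cond P {ω | M.rho ω = 0}).real {ω | M.rhoHat ω = 1} ≤
      ∫ ω, M.falseAlarmBound b rmax tauMax ω ∂(cond P {ω | M.rho ω = 0}) ∧
    (cond P {ω | M.rho ω = 1}).real {ω | M.rhoHat ω = 0} ≤
      ∫ ω, M.missedAlarmBound b rmax ω ∂(cond P {ω | M.rho ω = 1}) := by
  have hr : ∀ ω, ‖M.r ω‖ ≤ ‖rmax ω‖ := fun ω => hrmax ω (hres ω)
  have ht : ∀ ω, ‖M.tauCov ω‖ ≤ ‖tauMax ω‖ := fun ω => htauMax ω (htau ω)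
  have h0 := M.condProb_rhoHat_eq_one_le b hrmax_ne hr ht
  have h1 := M.condProb_rhoHat_eq_zero_le b hrmax_ne hr
  refine ⟨h0, h1, ?_, ?_⟩
  · refine cond_real_le_integral_of_condExp_le M.given_le M.measurableSet_rho_eq_zero ?_
      (M.integrable_falseAlarmBound b hrmax_meas hrmax_ne htauMax_meas) h0
    rw [M.setOf_rhoHat_eq_one]
    exact M.measurableSet_rhoHat_eq_zero.compl
  · exact cond_real_le_integral_of_condExp_le M.given_le M.measurableSet_rho_eq_one
      M.measurableSet_rhoHat_eq_zero (M.integrable_missedAlarmBound b hrmax_meas hrmax_ne) h1
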